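/- Let $n$ be a positive integer and let $\mathbf{A}$ be a compact set of real $n\times n$ matrices. Consider the linear switched system $$\dot x(t)=A(t)x(t),\qquad x\in\mathbb{R}^n,\qquad A(\cdot):[0,\infty)\to\mathbf{A}\ \text{ an arbitrary measurable function (a switching function)},$$ and, for a switching function $A(\cdot)$ and $x_0\in\mathbb{R}^n$, let $t\mapsto\phi^{A(\cdot)}_t(x_0)$, $t\ge 0$, be its Carathéodory solution with initial value $x_0$. Suppose that the origin is globally uniformly exponentially stable (GUES), i.e. there are constants $M>0$ and $\lambda>0$ such that $$\|\phi^{A(\cdot)}_t(x_0)\|\le M e^{-\lambda t}\|x_0\|\qquad\text{for every } x_0\in\mathbb{R}^n,\ t>0 \text{ and every switching function } A(\cdot).$$ Then the system admits a polynomial common Lyapunov function: there is a polynomial $V:\mathbb{R}^n\to\mathbb{R}$ in $n$ variables with $V(0)=0$ and $V(x)>0$ for all $x\neq 0$ such that, for every switching function $A(\cdot)$ and every $x_0\in\mathbb{R}^n$ for which the trajectory $t\mapsto\phi^{A(\cdot)}_t(x_0)$ is not constant, the function $t\mapsto V(\phi^{A(\cdot)}_t(x_0))$ is strictly decreasing on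 $[0,\infty)$. -/

import Mathlib

open MeasureTheory Set

namespace SwitchedSystem

/-- `A` is a switching function of the linear switched system defined by the set `S` of
`n × n` real matrices: on `[0, ∞)` it is Lebesgue measurable (entrywise) and takes its values in `S`.
Its values at negative times are irrelevant. -/
def IsSwitching {n : ℕ} (S : Set (Matrix (Fin n) (Fin n) ℝ))
    (A : ℝ → Matrix (Fin n) (Fin n) ℝ) : Prop :=
  (∀ i j : Fin n, AEMeasurable (fun t : ℝ => A t i j) (volume.restrict (Ici (0 : ℝ)))) ∧
    ∀ t : ℝ, 0 ≤ t → A t ∈ S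

/-- `x` is a Carathéodory solution on `[0, ∞)` of `ẋ(t) = A(t) x(t)`: it is absolutely continuous
on every `[0, T]` and satisfies the equation at almost every `t > 0`. For a switching function
`A` with bounded values and each initial value `x 0`, it is the trajectory `t ↦ φ_t (x 0)`,
where `φ` is the flow of the equation. Its values at negative times are irrelevant. -/
def IsSolution {n : ℕ} (A : ℝ → Matrix (Fin n) (Fin n) ℝ)
    (x : ℝ → EuclideanSpace ℝ (Fin n)) : Prop :=
  (∀ T : ℝ, 0 ≤ T → AbsolutelyContinuousOnInterval x 0 T) ∧
    ∀ᵐ t : ℝ, 0 < t → HasDerivAt x (Matrix.toEuclideanLin (A t) (x t)) t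

/-- The origin is globally uniformly exponentially stable for the switched system `ẋ = A(t) x`,
`A(·) : [0, ∞) → S` measurable, with respect to the Euclidean norm. -/
def IsGUES {n : ℕ} (S : Set (Matrix (Fin n) (Fin n) ℝ)) : Prop :=
  ∃ M lam : ℝ, 0 < M ∧ 0 < lam ∧
    ∀ A : ℝ → Matrix (Fin n) (Fin n) ℝ, IsSwitching S A →
      ∀ x : ℝ → EuclideanSpace ℝ (Fin n), IsSolution A x →
        ∀ t : ℝ, 0 < t → ‖x t‖ ≤ M * Real.exp (-lam * t) * ‖x 0‖

/-- `V` is a common Lyapunov function for the switched system defined by `S`: it is continuous,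
positive definite, and strictly decreasing along every nonconstant trajectory. -/
structure IsCommonLyapunov {n : ℕ} (S : Set (Matrix (Fin n) (Fin n) ℝ))
    (V : EuclideanSpace ℝ (Fin n) → ℝ) : Prop where
  continuous : Continuous V
  map_zero : V 0 = 0
  pos : ∀ x : EuclideanSpace ℝ (Fin n), x ≠ 0 → 0 < V x
  strictAntiOn : ∀ A : ℝ → Matrix (Fin n) (Fin n) ℝ, IsSwitching S A →
    ∀ x : ℝ → EuclideanSpace ℝ (Fin n), IsSolution A x →
      (∃ t : ℝ, 0 ≤ t ∧ x t ≠ x 0) → StrictAntiOn (fun t : ℝ => V (x t)) (Ici (0 : ℝ))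

end SwitchedSystem

/-! Let 𝒲 be the set of operators `exp(λt) Φ`, where Φ is a time-`t` flow map of a piecewise
constant switching function. GUES makes 𝒲 bounded, and `N(x) = sup ‖Ψ x‖` over 𝒲 is a norm with
`N(exp(hA) x) ≤ exp(-λh) N(x)`. For small `h` the Euler step `x + hAx` is contracted too, as its
error is O(h²). The contraction has a margin, so by compactness a finite net F of 𝒲 can replace 𝒲
(`exists_finite_contracting_family`).

The maximum of `‖Ψ x‖` over F is not polynomial, but `∑ ‖Ψ x‖ ^ (2(q+1))` is. For large `q` its
derivative along `Ax` is dominated by the largest terms, which the contraction makes negative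
(`sum_normSq_pow_mul_inner_neg`). Measurable switching enters only when this pointwise inequality is
integrated along absolutely continuous trajectories (`isCommonLyapunov_of_deriv_neg`). -/

namespace SwitchedSystem

open scoped RealInnerProductSpace

/-! ### Power means in place of the maximum norm -/

section Algebra

variable {E : Type*} [NormedAddCommGroup E] [InnerProductSpace ℝ E]

/-- If the family `u` has maximal norm `W` and every `u i + v i` has norm at most `ρ W`, then a
sufficiently high power mean of the norms decreases in the direction `v`. -/
lemma sum_normSq_pow_mul_inner_neg {ι : Type*} [DecidableEq ι] (F : Finset ι) (u v : ι → E)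
    {ρ W : ℝ} (q : ℕ) (hρ0 : 0 ≤ ρ) (hρ : ρ < 1) (hW : 0 < W) (hu : ∀ i ∈ F, ‖u i‖ ≤ W)
    (huv : ∀ i ∈ F, ‖u i + v i‖ ≤ ρ * W) {k : ι} (hk : k ∈ F) (hkW : ‖u k‖ = W)
    (hq : (F.card : ℝ) * (((1 + ρ) / 2) ^ 2) ^ q < (1 - ρ) / 2) :
    ∑ i ∈ F, (‖u i‖ ^ 2) ^ q * ⟪u i, v i⟫ < 0 := by
  have key : ∀ i ∈ F, ⟪u i, v i⟫ ≤ ‖u i‖ * (ρ * W - ‖u i‖) := by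
    intro i hi
    have h1 : ⟪u i, v i⟫ = ⟪u i, u i + v i⟫ - ‖u i‖ ^ 2 := by
      rw [inner_add_right, real_inner_self_eq_norm_sq]; ring
    have h2 : ⟪u i, u i + v i⟫ ≤ ‖u i‖ * (ρ * W) :=
      (real_inner_le_norm _ _).trans (mul_le_mul_of_nonneg_left (huv i hi) (norm_nonneg _))
    rw [h1]; nlinarith
  set θ : ℝ := (1 + ρ) / 2 with hθ
  have hg : ∀ i ∈ F, (‖u i‖ ^ 2) ^ q * ⟪u i, v i⟫ ≤ (θ ^ 2) ^ q * ((W ^ 2) ^ q * W ^ 2) := by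
    intro i hi
    have hnn : 0 ≤ (θ ^ 2) ^ q * ((W ^ 2) ^ q * W ^ 2) := by positivity
    -- Since `θ` is the midpoint of `ρ` and 1, norms above `θ W` exceed `ρ W` and give nonpositive
    -- terms; below it, the power supplies the small factor `θ ^ (2q)`.
    rcases le_total (θ * W) ‖u i‖ with h | h
    · refine le_trans (mul_nonpos_of_nonneg_of_nonpos (by positivity) ?_) hnn
      refine (key i hi).trans (mul_nonpos_of_nonneg_of_nonpos (norm_nonneg _) ?_)
      rw [hθ] at h; nlinarith
    · have h1 : ⟪u i, v i⟫ ≤ W ^ 2 := by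
        refine (key i hi).trans ?_
        have := hu i hi
        have := norm_nonneg (u i)
        nlinarith [mul_nonneg this (sub_nonneg.2 hρ.le), mul_nonneg this hW.le,
          mul_nonneg (mul_nonneg this hW.le) (sub_nonneg.2 hρ.le)]
      have h2 : (‖u i‖ ^ 2) ^ q ≤ (θ ^ 2) ^ q * (W ^ 2) ^ q := by
        rw [← mul_pow, ← mul_pow]; gcongr
      calc _ ≤ (‖u i‖ ^ 2) ^ q * W ^ 2 := by gcongr
        _ ≤ ((θ ^ 2) ^ q * (W ^ 2) ^ q) * W ^ 2 := by gcongr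
        _ = _ := by ring
  have hfk : (‖u k‖ ^ 2) ^ q * ⟪u k, v k⟫ ≤ -((1 - ρ) / 2) * ((W ^ 2) ^ q * W ^ 2) := by
    have h1 := key k hk
    rw [hkW] at h1 ⊢
    have h2 : ⟪u k, v k⟫ ≤ -((1 - ρ) / 2) * W ^ 2 := by nlinarith [mul_pos hW hW]
    calc _ ≤ (W ^ 2) ^ q * (-((1 - ρ) / 2) * W ^ 2) := by gcongr
      _ = _ := by ring
  have hsum : ∑ i ∈ F.erase k, (‖u i‖ ^ 2) ^ q * ⟪u i, v i⟫
      ≤ F.card * ((θ ^ 2) ^ q * ((W ^ 2) ^ q * W ^ 2)) := by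
    refine (Finset.sum_le_card_nsmul _ _ _ fun i hi => hg i (Finset.mem_of_mem_erase hi)).trans ?_
    rw [nsmul_eq_mul]
    have : ((F.erase k).card : ℝ) ≤ F.card := by exact_mod_cast Finset.card_erase_le
    gcongr
  rw [← Finset.add_sum_erase F _ hk]
  have hWq : 0 < (W ^ 2) ^ q * W ^ 2 := by positivity
  nlinarith

end Algebra

/-! ### Monotonicity from almost everywhere derivatives -/

section AbsolutelyContinuous

lemma sub_pos_of_ae_deriv_pos {f : ℝ → ℝ} {s t : ℝ} (hst : s < t)
    (hf : AbsolutelyContinuousOnInterval f s t) (hd : ∀ᵐ r, r ∈ Ioc s t → 0 < deriv f r) :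
    f s < f t := by
  rw [← sub_pos, ← hf.integral_deriv_eq_sub]
  have hd' : ∀ᵐ r ∂volume.restrict (Ioc s t), 0 < deriv f r :=
    (ae_restrict_iff' measurableSet_Ioc).2 hd
  rw [intervalIntegral.integral_pos_iff_support_of_nonneg_ae' _ hf.intervalIntegrable_deriv]
  · refine ⟨hst, ?_⟩
    calc (0 : ENNReal) < volume (Ioc s t) := by simpa using hst
      _ ≤ _ := measure_mono_ae (by filter_upwards [hd] with r hr h using ⟨(hr h).ne', h⟩)
  · rw [uIoc_of_le hst.le]
    filter_upwards [hd'] with r hr using hr.le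

lemma le_of_ae_deriv_nonneg {f : ℝ → ℝ} {s t : ℝ} (hst : s ≤ t)
    (hf : AbsolutelyContinuousOnInterval f s t) (hd : ∀ᵐ r, r ∈ Icc s t → 0 ≤ deriv f r) :
    f s ≤ f t := by
  rw [← sub_nonneg, ← hf.integral_deriv_eq_sub]
  refine intervalIntegral.integral_nonneg_of_ae_restrict hst ?_
  exact (ae_restrict_iff' measurableSet_Icc).2 hd

lemma absolutelyContinuous_eval {n : ℕ} {x : ℝ → EuclideanSpace ℝ (Fin n)} {a b : ℝ}
    (hx : AbsolutelyContinuousOnInterval x a b) (P : MvPolynomial (Fin n) ℝ) :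
    AbsolutelyContinuousOnInterval
      (fun t => MvPolynomial.eval (fun i : Fin n => x t i) P) a b := by
  induction P using MvPolynomial.induction_on with
  | C c =>
    simp only [MvPolynomial.eval_C]
    exact ((LipschitzWith.const c).lipschitzOnWith (s := uIcc a b)).absolutelyContinuousOnInterval
  | add p q hp hq =>
    simp only [map_add]
    exact hp.add hq
  | mul_X p i hp =>
    simp only [map_mul, MvPolynomial.eval_X]
    refine hp.mul ?_
    refine squeeze_zero (fun t => Finset.sum_nonneg fun i _ => dist_nonneg) (fun t => ?_) hx
    refine Finset.sum_le_sum fun j _ => ?_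
    rw [dist_eq_norm, dist_eq_norm]
    exact PiLp.norm_apply_le (x (t.2 j).1 - x (t.2 j).2) i

end AbsolutelyContinuous

lemma exists_eval_eq_normSq {n : ℕ}
    (Ψ : EuclideanSpace ℝ (Fin n) →L[ℝ] EuclideanSpace ℝ (Fin n)) :
    ∃ P : MvPolynomial (Fin n) ℝ, ∀ x : EuclideanSpace ℝ (Fin n),
      MvPolynomial.eval (fun i : Fin n => x i) P = ‖Ψ x‖ ^ 2 := by
  refine ⟨∑ j, (∑ k, MvPolynomial.C (Ψ (EuclideanSpace.single k 1) j) * MvPolynomial.X k) ^ 2,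
    fun x => ?_⟩
  have hx : Ψ x = ∑ k, x k • Ψ (EuclideanSpace.single k 1) := by
    conv_lhs => rw [← (EuclideanSpace.basisFun (Fin n) ℝ).sum_repr x]
    simp
  rw [EuclideanSpace.real_norm_sq_eq, hx]
  simp [mul_comm]

/-! ### Flow maps and the finite contracting family -/

section Flow

variable {n : ℕ}

/-- The operator of a matrix on Euclidean space. -/
noncomputable abbrev op (A : Matrix (Fin n) (Fin n) ℝ) :
    EuclideanSpace ℝ (Fin n) →L[ℝ] EuclideanSpace ℝ (Fin n) :=
  Matrix.toEuclideanCLM (n := Fin n) (𝕜 := ℝ) A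

lemma op_apply (A : Matrix (Fin n) (Fin n) ℝ) (x : EuclideanSpace ℝ (Fin n)) :
    Matrix.toEuclideanLin A x = op A x := rfl

/-- Time-`t` flow maps of piecewise constant switching functions with values in `S`. -/
inductive IsFlowMap (S : Set (Matrix (Fin n) (Fin n) ℝ)) :
    ℝ → (EuclideanSpace ℝ (Fin n) →L[ℝ] EuclideanSpace ℝ (Fin n)) → Prop
  | one : IsFlowMap S 0 1
  | append {t h : ℝ} {Φ : EuclideanSpace ℝ (Fin n) →L[ℝ] EuclideanSpace ℝ (Fin n)}
      {A : Matrix (Fin n) (Fin n) ℝ} : IsFlowMap S t Φ → A ∈ S → 0 ≤ h →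
      IsFlowMap S (t + h) (NormedSpace.exp (h • op A) * Φ)

@[simp]
lemma exp_zero_smul (a : EuclideanSpace ℝ (Fin n) →L[ℝ] EuclideanSpace ℝ (Fin n)) :
    NormedSpace.exp ((0 : ℝ) • a) = 1 := by
  rw [zero_smul ℝ a, NormedSpace.exp_zero]

/-- The constructor adds the latest piece of the motion; the contraction estimate needs a new
earliest piece. -/
lemma IsFlowMap.prepend {S : Set (Matrix (Fin n) (Fin n) ℝ)} {t h : ℝ}
    {Φ : EuclideanSpace ℝ (Fin n) →L[ℝ] EuclideanSpace ℝ (Fin n)}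
    {A : Matrix (Fin n) (Fin n) ℝ} (hΦ : IsFlowMap S t Φ) (hA : A ∈ S) (hh : 0 ≤ h) :
    IsFlowMap S (t + h) (Φ * NormedSpace.exp (h • op A)) := by
  induction hΦ with
  | one => simpa using IsFlowMap.append IsFlowMap.one hA hh
  | append _ hB hk ih =>
    rw [add_right_comm, mul_assoc]
    exact ih.append hB hk

lemma hasDerivAt_exp_smul_apply (a : EuclideanSpace ℝ (Fin n) →L[ℝ] EuclideanSpace ℝ (Fin n))
    (x : EuclideanSpace ℝ (Fin n)) (t : ℝ) :
    HasDerivAt (fun s : ℝ => NormedSpace.exp (s • a) x) (a (NormedSpace.exp (t • a) x)) t := by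
  simpa using (hasDerivAt_exp_smul_const' (𝕂 := ℝ) a t).clm_apply (hasDerivAt_const t x)

lemma exists_lipschitzOnWith_exp
    (a : EuclideanSpace ℝ (Fin n) →L[ℝ] EuclideanSpace ℝ (Fin n))
    (x : EuclideanSpace ℝ (Fin n)) (t T : ℝ) :
    ∃ K, LipschitzOnWith K (fun s : ℝ => NormedSpace.exp ((s - t) • a) x) (Icc 0 T) := by
  have h : ContDiff ℝ 1 (fun s : ℝ => NormedSpace.exp ((s - t) • a) x) := by
    have h1 : ContDiff ℝ 1 (NormedSpace.exp :
        (EuclideanSpace ℝ (Fin n) →L[ℝ] EuclideanSpace ℝ (Fin n)) → _) :=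
      contDiff_iff_contDiffAt.2 fun x => (NormedSpace.exp_analytic (𝕂 := ℝ) x).contDiffAt
    fun_prop
  exact h.contDiffOn.exists_lipschitzOnWith (by decide) (convex_Icc _ _) isCompact_Icc

/-- Every flow map is realised by trajectories of the switched system. -/
lemma IsFlowMap.exists_solution {S : Set (Matrix (Fin n) (Fin n) ℝ)} (hS : S.Nonempty) {t : ℝ}
    {Φ : EuclideanSpace ℝ (Fin n) →L[ℝ] EuclideanSpace ℝ (Fin n)} (hΦ : IsFlowMap S t Φ)
    (x₀ : EuclideanSpace ℝ (Fin n)) :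
    0 ≤ t ∧ ∃ A x, IsSwitching S A ∧ (∀ T : ℝ, ∃ K, LipschitzOnWith K x (Icc 0 T)) ∧
      (∀ᵐ s : ℝ, 0 < s → HasDerivAt x (op (A s) (x s)) s) ∧ x 0 = x₀ ∧ x t = Φ x₀ := by
  induction hΦ with
  | one =>
    obtain ⟨B, hB⟩ := hS
    refine ⟨le_rfl, fun _ => B, fun s => NormedSpace.exp (s • op B) x₀,
      ⟨fun i j => aemeasurable_const, fun _ _ => hB⟩, fun T => ?_, ?_, by simp, by simp⟩
    · simpa using exists_lipschitzOnWith_exp (op B) x₀ 0 T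
    · exact Filter.Eventually.of_forall fun s _ => hasDerivAt_exp_smul_apply _ _ _
  | @append t h Φ B _ hB hh ih =>
    obtain ⟨ht, A, x, hA, hlip, hder, hx0, hxt⟩ := ih
    set z : ℝ → EuclideanSpace ℝ (Fin n) := fun s => NormedSpace.exp ((s - t) • op B) (x t)
      with hz
    have hzt : z t = x t := by simp [hz]
    have hzd : ∀ s, HasDerivAt z (op B (z s)) s := fun s =>
      (hasDerivAt_exp_smul_apply (op B) (x t) (s - t)).comp_sub_const s t
    -- Gluing by `min` and `max` makes the new path a sum of Lipschitz compositions; the pieces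
    -- match because `z t = x t`.
    refine ⟨by positivity, fun s => if s < t then A s else B,
      fun s => x (min s t) + (z (max s t) - z t), ⟨fun i j => ?_, fun s hs => ?_⟩, fun T => ?_,
      ?_, ?_, ?_⟩
    · have h1 : (fun s => (if s < t then A s else B) i j)
          = (Iio t).indicator (fun s => A s i j) + (Ici t).indicator (fun _ => B i j) := by
        ext s
        by_cases h : s < t <;> simp [h, indicator, not_le.2, not_lt.1]
      rw [h1]
      exact ((hA.1 i j).indicator measurableSet_Iio).add
        (aemeasurable_const.indicator measurableSet_Ici)
    · dsimp only
      split_ifs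
      exacts [hA.2 s hs, hB]
    · obtain ⟨K, hK⟩ := hlip t
      obtain ⟨L, hL⟩ := exists_lipschitzOnWith_exp (op B) (x t) t (max T t)
      have hmin : LipschitzWith 1 (fun s : ℝ => min s t) := LipschitzWith.id.min_const t
      have hmax : LipschitzWith 1 (fun s : ℝ => max s t) := LipschitzWith.id.max_const t
      exact ⟨_, (hK.comp hmin.lipschitzOnWith fun s hs => ⟨le_min hs.1 ht, min_le_right _ _⟩).add
        ((hL.comp hmax.lipschitzOnWith fun s hs =>
          ⟨ht.trans (le_max_right _ _), max_le_max_right _ hs.2⟩).sub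
            (LipschitzWith.const (z t)).lipschitzOnWith)⟩
    · filter_upwards [hder, Measure.ae_ne volume t] with s hs hst hs0
      rcases lt_or_gt_of_ne hst with h | h
      · have he : (fun s => x (min s t) + (z (max s t) - z t)) =ᶠ[nhds s] x := by
          filter_upwards [Iio_mem_nhds h] with r hr
          simp [min_eq_left (mem_Iio.1 hr).le, max_eq_right (mem_Iio.1 hr).le]
        rw [he.eq_of_nhds, if_pos h]
        exact (hs hs0).congr_of_eventuallyEq he
      · have he : (fun s => x (min s t) + (z (max s t) - z t)) =ᶠ[nhds s] z := by
          filter_upwards [Ioi_mem_nhds h] with r hr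
          simp [min_eq_right (mem_Ioi.1 hr).le, max_eq_left (mem_Ioi.1 hr).le, hzt]
        rw [he.eq_of_nhds, if_neg h.not_gt]
        exact (hzd s).congr_of_eventuallyEq he
    · simp [ht, hx0]
    · simp [hh, hz, hxt]

lemma exists_flowMap_bound {S : Set (Matrix (Fin n) (Fin n) ℝ)} (hS : S.Nonempty)
    (hG : IsGUES S) : ∃ M lam : ℝ, 1 ≤ M ∧ 0 < lam ∧ ∀ t Φ, IsFlowMap S t Φ →
      0 ≤ t ∧ ∀ x, Real.exp (lam * t) * ‖Φ x‖ ≤ M * ‖x‖ := by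
  obtain ⟨M, lam, hM, hlam, hb⟩ := hG
  -- GUES speaks only of `t > 0`; the 1 covers the identity at time 0.
  refine ⟨max M 1, lam, le_max_right _ _, hlam, fun t Φ hΦ =>
    ⟨(hΦ.exists_solution hS 0).1, fun x₀ => ?_⟩⟩
  obtain ⟨ht, A, x, hA, hlip, hder, hx0, hxt⟩ := hΦ.exists_solution hS x₀
  rw [← hxt, ← hx0]
  rcases ht.eq_or_lt with rfl | ht
  · simpa using le_mul_of_one_le_left (norm_nonneg (x 0)) (le_max_right M 1)
  · have hx : IsSolution A x := by
      refine ⟨fun T hT => ?_, hder⟩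
      obtain ⟨K, hK⟩ := hlip T
      rw [← uIcc_of_le hT] at hK
      exact hK.absolutelyContinuousOnInterval
    calc Real.exp (lam * t) * ‖x t‖
        ≤ Real.exp (lam * t) * (M * Real.exp (-lam * t) * ‖x 0‖) := by
          gcongr; exact hb A hA x hx t ht
      _ = (Real.exp (lam * t) * Real.exp (-lam * t)) * (M * ‖x 0‖) := by ring
      _ = M * ‖x 0‖ := by rw [← Real.exp_add]; simp
      _ ≤ _ := by gcongr; exact le_max_left _ _

lemma exists_op_bound {S : Set (Matrix (Fin n) (Fin n) ℝ)} (hS : IsCompact S) :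
    ∃ K : ℝ, 0 ≤ K ∧ ∀ A ∈ S, ∀ x, ‖op A x‖ ≤ K * ‖x‖ := by
  have hc : Continuous (op : Matrix (Fin n) (Fin n) ℝ → _) :=
    LinearMap.continuous_of_finiteDimensional
      (Matrix.toEuclideanCLM (n := Fin n) (𝕜 := ℝ)).toAlgEquiv.toLinearMap
  obtain ⟨K, hK⟩ := hS.exists_bound_of_continuousOn hc.continuousOn
  exact ⟨max K 0, le_max_right _ _, fun A hA x =>
    (op A).le_of_opNorm_le ((hK A hA).trans (le_max_left _ _)) x⟩

/-- Second-order Taylor bound for a bounded orbit of a one-parameter semigroup. -/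
lemma norm_exp_apply_sub_le {a : EuclideanSpace ℝ (Fin n) →L[ℝ] EuclideanSpace ℝ (Fin n)}
    {K M h : ℝ} (hK : ∀ x, ‖a x‖ ≤ K * ‖x‖) (hK0 : 0 ≤ K) (hh : 0 ≤ h)
    (x : EuclideanSpace ℝ (Fin n))
    (hM : ∀ s : ℝ, 0 ≤ s → ‖NormedSpace.exp (s • a) x‖ ≤ M * ‖x‖) :
    ‖NormedSpace.exp (h • a) x - x - h • a x‖ ≤ K * (K * (M * ‖x‖)) * h * h := by
  have h1 : ∀ s ∈ Icc 0 h, ‖NormedSpace.exp (s • a) x - x‖ ≤ K * (M * ‖x‖) * s := by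
    intro s hs
    simpa using norm_image_sub_le_of_norm_deriv_le_segment'
      (f := fun s : ℝ => NormedSpace.exp (s • a) x) (a := 0) (b := h) (C := K * (M * ‖x‖))
      (fun r _ => (hasDerivAt_exp_smul_apply a x r).hasDerivWithinAt)
      (fun r hr => (hK _).trans (by gcongr; exact hM r hr.1)) s hs
  -- The remainder has derivative `a (exp(ra) x - x)`, which `h1` bounds.
  have h2 := norm_image_sub_le_of_norm_deriv_le_segment'
      (f := fun s : ℝ => NormedSpace.exp (s • a) x - s • a x) (a := 0) (b := h)
      (C := K * (K * (M * ‖x‖) * h))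
      (fun r _ => ((hasDerivAt_exp_smul_apply a x r).sub
        ((hasDerivAt_id r).smul_const (a x))).hasDerivWithinAt)
      (fun r hr => by
        have h3 : a (NormedSpace.exp (r • a) x) - (1 : ℝ) • a x
            = a (NormedSpace.exp (r • a) x - x) := by simp
        rw [h3]
        refine (hK _).trans ?_
        gcongr
        refine (h1 r (Ico_subset_Icc_self hr)).trans ?_
        have : 0 ≤ K * (M * ‖x‖) :=
          mul_nonneg hK0 ((norm_nonneg _).trans (by simpa using hM 0 le_rfl))
        gcongr
        exact hr.2.le) h (right_mem_Icc.2 hh)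
  simp only [exp_zero_smul, zero_smul, sub_zero] at h2
  calc _ = ‖NormedSpace.exp (h • a) x - h • a x
        - (1 : EuclideanSpace ℝ (Fin n) →L[ℝ] EuclideanSpace ℝ (Fin n)) x‖ := by
        congr 1; simp; abel
    _ ≤ _ := h2.trans (by linarith)

/-- As `exp(-λh) ≤ 1 - λh + (λh)²` for `λh ≤ 1`, it suffices that `(λ² + C) h < λ`: the linear gain
beats the quadratic errors. -/
lemma exists_step {C lam : ℝ} (hC : 0 ≤ C) (hlam : 0 < lam) :
    ∃ h : ℝ, 0 < h ∧ Real.exp (-(lam * h)) + C * h * h < 1 := by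
  set h : ℝ := lam / (2 * (lam ^ 2 + C + lam)) with hh
  have hD : 0 < lam ^ 2 + C + lam := by positivity
  have hpos : 0 < h := by positivity
  have hlh : h * (2 * (lam ^ 2 + C + lam)) = lam := by rw [hh]; field_simp
  refine ⟨h, hpos, ?_⟩
  have h1 : lam * h ≤ 1 := by
    nlinarith [mul_pos hpos hlam, mul_nonneg hpos.le hC, mul_pos (mul_pos hpos hlam) hlam,
      sq_nonneg (lam - 1)]
  have h2 := Real.abs_exp_sub_one_sub_id_le (x := -(lam * h)) (by
    rw [abs_neg, abs_of_nonneg (by positivity)]; exact h1)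
  have h3 := (abs_le.1 h2).2
  nlinarith [mul_pos hpos hpos, mul_pos (mul_pos hpos hpos) hlam]

/-- Under uniform exponential stability, finitely many operators define a norm which is uniformly
contracted by a single Euler step. -/
theorem exists_finite_contracting_family {S : Set (Matrix (Fin n) (Fin n) ℝ)} (hS : IsCompact S)
    (hne : S.Nonempty) (hG : IsGUES S) :
    ∃ (F : Finset (EuclideanSpace ℝ (Fin n) →L[ℝ] EuclideanSpace ℝ (Fin n))) (ρ h : ℝ),
      0 ≤ ρ ∧ ρ < 1 ∧ 0 < h ∧ (∀ x b, (∀ Φ ∈ F, ‖Φ x‖ ≤ b) → ∀ A ∈ S, ∀ Ψ ∈ F,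
        ‖Ψ x + h • Ψ (op A x)‖ ≤ ρ * b) ∧ ∀ x, x ≠ 0 → ∃ Φ ∈ F, Φ x ≠ 0 := by
  obtain ⟨M, lam, hM, hlam, hflow⟩ := exists_flowMap_bound hne hG
  obtain ⟨K, hK0, hK⟩ := exists_op_bound hS
  obtain ⟨h, hh, hstep⟩ := exists_step (C := M * (K * (K * M))) (by positivity) hlam
  set r : ℝ := Real.exp (-(lam * h)) + M * (K * (K * M)) * h * h with hr
  have hr0 : 0 < r := by positivity
  set 𝒲 : Set (EuclideanSpace ℝ (Fin n) →L[ℝ] EuclideanSpace ℝ (Fin n)) :=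
    {Ψ | ∃ t Φ, IsFlowMap S t Φ ∧ Ψ = Real.exp (lam * t) • Φ} with hW
  have hWM : ∀ Ψ ∈ 𝒲, ∀ x, ‖Ψ x‖ ≤ M * ‖x‖ := by
    rintro _ ⟨t, Φ, hΦ, rfl⟩ x
    simpa [norm_smul] using (hflow t Φ hΦ).2 x
  have hone : 1 ∈ 𝒲 := ⟨0, 1, .one, by simp⟩
  have hbdd : TotallyBounded 𝒲 := by
    refine (isCompact_closedBall (0 : EuclideanSpace ℝ (Fin n) →L[ℝ] _) M).totallyBounded.subset ?_
    intro Ψ hΨ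
    rw [mem_closedBall_zero_iff]
    exact Ψ.opNorm_le_bound (by positivity) (hWM Ψ hΨ)
  obtain ⟨F, hFW, hFfin, hcov⟩ :=
    Metric.finite_approx_of_totallyBounded hbdd ((1 - r) / 2) (by linarith)
  have hnear : ∀ x b, (∀ Φ ∈ F, ‖Φ x‖ ≤ b) → ∀ Ψ ∈ 𝒲, ‖Ψ x‖ ≤ b + (1 - r) / 2 * ‖x‖ := by
    intro x b hb Ψ hΨ
    obtain ⟨Φ, hΦ, hd⟩ := mem_iUnion₂.1 (hcov hΨ)
    rw [Metric.mem_ball, dist_eq_norm] at hd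
    calc ‖Ψ x‖ = ‖Φ x + (Ψ - Φ) x‖ := by simp
      _ ≤ _ := (norm_add_le _ _).trans (add_le_add (hb Φ hΦ) ((Ψ - Φ).le_of_opNorm_le hd.le x))
  -- The identity lies in 𝒲, so the net error `(1 - r)/2 * ‖x‖` can be absorbed on the left.
  have hnorm : ∀ x b, (∀ Φ ∈ F, ‖Φ x‖ ≤ b) → ‖x‖ ≤ b / ((1 + r) / 2) := by
    intro x b hb
    have := hnear x b hb 1 hone
    rw [le_div_iff₀ (by positivity)]
    simp only [one_apply_eq_self] at this
    linarith
  refine ⟨hFfin.toFinset, r / ((1 + r) / 2), h, by positivity, ?_, hh, ?_, ?_⟩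
  · rw [div_lt_one (by positivity)]; linarith
  · intro x b hb A hA Ψ hΨ
    simp only [Finite.mem_toFinset] at hb hΨ
    have hx := hnorm x b hb
    set c := b / ((1 + r) / 2) with hc
    have hall : ∀ Ψ ∈ 𝒲, ‖Ψ x‖ ≤ c := fun Ψ hΨ => by
      refine (hnear x b hb Ψ hΨ).trans ?_
      have hbc : b = c * ((1 + r) / 2) := by rw [hc]; field_simp
      rw [hbc]
      nlinarith
    have hexp : ∀ s : ℝ, 0 ≤ s → ‖NormedSpace.exp (s • op A) x‖ ≤ M * ‖x‖ := fun s hs => by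
      have h1 := (hflow _ _ (IsFlowMap.one.append hA hs)).2 x
      refine le_trans (le_mul_of_one_le_left (norm_nonneg _) ?_) (by simpa using h1)
      exact Real.one_le_exp (by positivity)
    have h1 : ‖Ψ (NormedSpace.exp (h • op A) x)‖ ≤ Real.exp (-(lam * h)) * c := by
      obtain ⟨t, Φ, hΦ, rfl⟩ := hFW hΨ
      -- Following `exp(hA)` by Φ is again a flow map, of time `t + h`, so 𝒲 contains it with the
      -- extra weight `exp(λh)`.
      have h2 := hall _ ⟨_, _, hΦ.prepend hA hh.le, rfl⟩
      have h3 : Real.exp (lam * t) = Real.exp (-(lam * h)) * Real.exp (lam * (t + h)) := by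
        rw [← Real.exp_add]; ring_nf
      rw [h3, mul_smul, smul_apply, norm_smul, Real.norm_eq_abs, Real.abs_exp]
      gcongr
      exact h2
    have h2 := norm_exp_apply_sub_le (hK A hA) hK0 hh.le x hexp
    calc ‖Ψ x + h • Ψ (op A x)‖
        = ‖Ψ (NormedSpace.exp (h • op A) x)
            - Ψ (NormedSpace.exp (h • op A) x - x - h • op A x)‖ := by
          congr 1; simp only [map_sub, map_smul]; abel
      _ ≤ Real.exp (-(lam * h)) * c + M * (K * (K * (M * c)) * h * h) := by
          refine (norm_sub_le _ _).trans (add_le_add h1 ((hWM Ψ (hFW hΨ) _).trans ?_))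
          gcongr
          refine h2.trans ?_
          gcongr
      _ = r * c := by rw [hr]; ring
      _ = _ := by rw [hc]; ring
  · intro x hx
    by_contra! hcon
    have := hnorm x 0 fun Φ hΦ => by simp [hcon Φ (by simpa using hΦ)]
    simp at this
    exact hx this

end Flow

/-! ### Decrease along arbitrary trajectories -/

variable {n : ℕ}

/-- A nonzero trajectory of a system with bounded coefficients never reaches the origin. -/
lemma IsSolution.ne_zero {S : Set (Matrix (Fin n) (Fin n) ℝ)} (hS : IsCompact S)
    {A : ℝ → Matrix (Fin n) (Fin n) ℝ} (hA : IsSwitching S A)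
    {x : ℝ → EuclideanSpace ℝ (Fin n)} (hx : IsSolution A x) (h0 : x 0 ≠ 0) {t : ℝ}
    (ht : 0 ≤ t) : x t ≠ 0 := by
  obtain ⟨K, hK0, hK⟩ := exists_op_bound hS
  obtain ⟨P, hP⟩ := exists_eval_eq_normSq (n := n) 1
  -- Grönwall backwards: `exp(2Ks) ‖x s‖²` is nondecreasing, hence never falls to 0.
  have hac : AbsolutelyContinuousOnInterval
      ((fun s => Real.exp (2 * K * s)) * fun s => ‖x s‖ ^ 2) 0 t := by
    refine AbsolutelyContinuousOnInterval.mul (ContDiffOn.absolutelyContinuousOnInterval ?_) ?_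
    · have : ContDiff ℝ 1 fun s => Real.exp (2 * K * s) := by fun_prop
      exact this.contDiffOn
    · simpa [hP] using absolutelyContinuous_eval (hx.1 t ht) P
  have hmono := le_of_ae_deriv_nonneg ht hac (by
    filter_upwards [hx.2, Measure.ae_ne volume 0] with s hs hs0 hst
    have hd := hs (lt_of_le_of_ne hst.1 hs0.symm)
    rw [op_apply] at hd
    have he : HasDerivAt (fun s => Real.exp (2 * K * s)) (Real.exp (2 * K * s) * (2 * K)) s := by
      simpa using ((hasDerivAt_id s).const_mul (2 * K)).exp
    rw [(he.mul hd.norm_sq).deriv]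
    have h1 : -(K * ‖x s‖ ^ 2) ≤ ⟪x s, op (A s) (x s)⟫ := by
      have h2 := (abs_le.1 (abs_real_inner_le_norm (x s) (op (A s) (x s)))).1
      have h3 := mul_le_mul_of_nonneg_left (hK _ (hA.2 s hst.1) (x s)) (norm_nonneg (x s))
      nlinarith
    have h4 : Real.exp (2 * K * s) * (2 * K) * ‖x s‖ ^ 2
        + Real.exp (2 * K * s) * (2 * ⟪x s, op (A s) (x s)⟫)
        = 2 * Real.exp (2 * K * s) * (K * ‖x s‖ ^ 2 + ⟪x s, op (A s) (x s)⟫) := by ring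
    rw [h4]
    exact mul_nonneg (by positivity) (by linarith))
  intro hxt
  simp [hxt] at hmono
  exact h0 hmono

/-- A polynomial all of whose derivatives along the vector fields of `S` are negative decreases
strictly along every nonconstant trajectory. -/
lemma isCommonLyapunov_of_deriv_neg {S : Set (Matrix (Fin n) (Fin n) ℝ)} (hS : IsCompact S)
    (hG : IsGUES S) (P : MvPolynomial (Fin n) ℝ) (V' : EuclideanSpace ℝ (Fin n) →
      EuclideanSpace ℝ (Fin n) → ℝ)
    (h0 : MvPolynomial.eval (fun _ => 0) P = 0)
    (hpos : ∀ x : EuclideanSpace ℝ (Fin n), x ≠ 0 → 0 < MvPolynomial.eval (fun i => x i) P)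
    (hV' : ∀ (x : ℝ → EuclideanSpace ℝ (Fin n)) (v : EuclideanSpace ℝ (Fin n)) (t : ℝ),
      HasDerivAt x v t →
        HasDerivAt (fun s => MvPolynomial.eval (fun i => x s i) P) (V' (x t) v) t)
    (hneg : ∀ x, x ≠ 0 → ∀ A ∈ S, V' x (op A x) < 0) :
    IsCommonLyapunov S (fun x : EuclideanSpace ℝ (Fin n) =>
      MvPolynomial.eval (fun i : Fin n => x i) P) where
  continuous := (MvPolynomial.continuous_eval P).comp (by fun_prop)
  map_zero := h0
  pos := hpos
  strictAntiOn := by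
    rintro A hA x hx ⟨τ, hτ0, hτ⟩ s hs t ht hst
    -- By GUES a trajectory starting at the origin stays there, so it is constant.
    have hx0 : x 0 ≠ 0 := by
      intro hx0
      obtain ⟨M, lam, -, -, hb⟩ := hG
      have hτ' : 0 < τ := lt_of_le_of_ne hτ0 (by rintro rfl; exact hτ rfl)
      have := hb A hA x hx τ hτ'
      rw [hx0, norm_zero, mul_zero, norm_le_zero_iff] at this
      exact hτ (this.trans hx0.symm)
    have hac : AbsolutelyContinuousOnInterval
        (fun r => MvPolynomial.eval (fun i => x r i) P) s t :=
      (absolutelyContinuous_eval (hx.1 t ht) P).mono (by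
        rw [uIcc_of_le hst.le, uIcc_of_le (mem_Ici.1 ht)]
        exact Icc_subset_Icc_left hs)
    have := sub_pos_of_ae_deriv_pos hst hac.neg (by
      filter_upwards [hx.2] with r hr hrs
      have hr0 : 0 < r := lt_of_le_of_lt hs hrs.1
      rw [(hV' x _ r (hr hr0)).neg.deriv, neg_pos]
      exact hneg _ (hx.ne_zero hS hA hx0 hr0.le) _ (hA.2 r hr0.le))
    simpa using this

end SwitchedSystem

/-! ### The polynomial Lyapunov function -/

theorem theorem1 (n : ℕ) (S : Set (Matrix (Fin n) (Fin n) ℝ)) (hS : IsCompact S)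
    (hGUES : SwitchedSystem.IsGUES S) :
    ∃ P : MvPolynomial (Fin n) ℝ, SwitchedSystem.IsCommonLyapunov S
      (fun x : EuclideanSpace ℝ (Fin n) => MvPolynomial.eval (fun i : Fin n => x i) P) := by
  classical
  choose Q hQ using SwitchedSystem.exists_eval_eq_normSq (n := n)
  -- An empty `S` has no switching functions, so `‖x‖²` serves vacuously.
  rcases S.eq_empty_or_nonempty with rfl | hne
  · refine ⟨Q 1, (MvPolynomial.continuous_eval _).comp (by fun_prop), by simpa using hQ 1 0,
      fun x hx => ?_, fun A hA => (hA.2 0 le_rfl).elim⟩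
    rw [hQ]
    exact pow_pos (norm_pos_iff.2 hx) 2
  obtain ⟨F, ρ, h, hρ0, hρ, hh, hF, hsep⟩ :=
    SwitchedSystem.exists_finite_contracting_family hS hne hGUES
  obtain ⟨q, hq⟩ : ∃ q : ℕ, (F.card : ℝ) * (((1 + ρ) / 2) ^ 2) ^ q < (1 - ρ) / 2 := by
    have h1 : Filter.Tendsto (fun q : ℕ => (F.card : ℝ) * (((1 + ρ) / 2) ^ 2) ^ q) Filter.atTop
        (nhds ((F.card : ℝ) * 0)) :=
      (tendsto_pow_atTop_nhds_zero_of_lt_one (by positivity) (by nlinarith)).const_mul _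
    rw [mul_zero] at h1
    exact (h1.eventually_lt_const (by linarith)).exists
  have heval : ∀ x : EuclideanSpace ℝ (Fin n),
      MvPolynomial.eval (fun i => x i) (∑ Ψ ∈ F, Q Ψ ^ (q + 1))
        = ∑ Ψ ∈ F, (‖Ψ x‖ ^ 2) ^ (q + 1) := fun x => by simp [hQ]
  refine ⟨∑ Ψ ∈ F, Q Ψ ^ (q + 1), SwitchedSystem.isCommonLyapunov_of_deriv_neg hS hGUES _
    (fun x v => ∑ Ψ ∈ F, ((q + 1 : ℕ) : ℝ) * (‖Ψ x‖ ^ 2) ^ q * (2 * inner ℝ (Ψ x) (Ψ v)))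
    (by simpa using heval 0) (fun x hx => ?_) (fun x v t hx => ?_) (fun x hx A hA => ?_)⟩
  · rw [heval]
    obtain ⟨Φ, hΦ, hΦx⟩ := hsep x hx
    refine Finset.sum_pos' (fun Ψ _ => by positivity) ⟨Φ, hΦ, ?_⟩
    have := norm_pos_iff.2 hΦx
    positivity
  · simp only [heval]
    refine HasDerivAt.fun_sum fun Ψ _ => ?_
    simpa using (Ψ.hasFDerivAt.comp_hasDerivAt t hx).norm_sq.fun_pow (q + 1)
  · obtain ⟨Φ, hΦ, hΦx⟩ := hsep x hx
    obtain ⟨k, hk, hmax⟩ := F.exists_max_image (fun Ψ => ‖Ψ x‖) ⟨Φ, hΦ⟩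
    have hneg := SwitchedSystem.sum_normSq_pow_mul_inner_neg F (fun Ψ => Ψ x)
      (fun Ψ => h • Ψ (SwitchedSystem.op A x)) q hρ0 hρ
      ((norm_pos_iff.2 hΦx).trans_le (hmax Φ hΦ)) hmax (hF x _ hmax A hA) hk rfl hq
    -- The contraction concerns the increment `h • Ψ (A x)`; rescaling by the positive factor
    -- `2(q+1)/h` recovers the derivative.
    have hrw : ∑ Ψ ∈ F, ((q + 1 : ℕ) : ℝ) * (‖Ψ x‖ ^ 2) ^ q
          * (2 * inner ℝ (Ψ x) (Ψ (SwitchedSystem.op A x)))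
        = (((q + 1 : ℕ) : ℝ) * 2 / h) * ∑ Ψ ∈ F, (‖Ψ x‖ ^ 2) ^ q
          * inner ℝ (Ψ x) (h • Ψ (SwitchedSystem.op A x)) := by
      rw [Finset.mul_sum]
      refine Finset.sum_congr rfl fun Ψ _ => ?_
      rw [inner_smul_right]
      field_simp
    rw [hrw]
    exact mul_neg_of_pos_of_neg (by positivity) hneg
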